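/- Let $\mathbb H=\mathbb R 1\oplus\mathbb R i\oplus\mathbb R j\oplus\mathbb R k$ be the algebra of real quaternions, graded by $(\mathbb Z_2)^3$ with $\deg 1=\gamma_1=(0,0,0)$, $\deg i=\gamma_2=(0,1,1)$, $\deg j=\gamma_3=(1,0,1)$, $\deg k=\gamma_4=(1,1,0)$ (the even elements of $(\mathbb Z_2)^3$), and let $\mathbb H^{\gamma}$ denote the component of degree $\gamma$; in particular $\mathbb H^0=\mathbb R$. For $\mathbf r=(r_1,r_2,r_3,r_4)\in\mathbb N^4$ let $\mathsf M^0(\mathbf r;\mathbb H)$ be the algebra of $4\times4$ block matrices $X=(X_{ku})$, with $X_{ku}$ of size $r_k\times r_u$ and with entries in $\mathbb H^{\gamma_k+\gamma_u}$ (purely even $(\mathbb Z_2)^3$-graded quaternionic matrices of degree $0$). The graded determinant $\Gamma\mathrm{det}$ is the unique map $\mathsf M^0(\mathbf r;\mathbb H)\to\mathbb H^0=\mathbb R$ such that 1. $\Gamma\mathrm{det}(XY)=\Gamma\mathrm{det}(X)\,\Gamma\mathrm{det}(Y)$ for all $X,Y$; 2. $\Gamma\mathrm{det}(X)=\prod_{k=1}^4\det(X_{kk})$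 if $X$ is block-diagonal; 3. $\Gamma\mathrm{det}(X)=1$ if $X$ is upper or lower block-unitriangular (block-triangular with identity matrices as diagonal blocks). With $N=r_1+r_2+r_3+r_4$, the Dieudonné determinant $\mathrm{Ddet}$ of quaternionic $N\times N$ matrices, with $\mathbb H^\times/[\mathbb H^\times,\mathbb H^\times]$ identified with $\mathbb R_{>0}$ through the norm $\|\cdot\|$, is the unique multiplicative map $\mathrm{Mat}_N(\mathbb H)\to\mathbb R$ that vanishes on singular matrices, equals $1$ on the transvections $1+cE_{ij}$ ($i\ne j$, $c\in\mathbb H$), and satisfies $\mathrm{Ddet}(\mathrm{diag}(a_1,\dots,a_N))=\prod_i\|a_i\|$. **Proposition.** For every $\mathbf r\in\mathbb N^4$ both maps are well defined, that is, exactly one map $\mathsf M^0(\mathbf r;\mathbb H)\to\mathbb R$ has the properties 1–3 and exactly one map $\mathrm{Mat}_N(\mathbb H)\to\mathbb R$ has the listed properties of $\mathrm{Ddet}$; and for every $X\in\mathsf M^0(\mathbf r;\mathbb H)$ $$|\Gamma\mathrm{det}(X)|=\mathrm{Ddet}(X).$$ -/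

import Mathlib

open scoped Quaternion

noncomputable section

namespace GradedQuaternion

/-- The degrees `γ₁, γ₂, γ₃, γ₄`: the even elements of `(ℤ/2)³`, in lexicographic order. -/
def evenDeg : Fin 4 → (Fin 3 → ZMod 2) :=
  ![![0, 0, 0], ![0, 1, 1], ![1, 0, 1], ![1, 1, 0]]

/-- The standard basis `1, i, j, k` of the quaternions. -/
def quatBasis : Fin 4 → ℍ[ℝ] :=
  ![⟨1, 0, 0, 0⟩, ⟨0, 1, 0, 0⟩, ⟨0, 0, 1, 0⟩, ⟨0, 0, 0, 1⟩]

/-- The homogeneous component `ℍ^γ` of the grading of `ℍ` in which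
`1, i, j, k` have degrees `(0,0,0), (0,1,1), (1,0,1), (1,1,0)`. -/
def quatComponent (γ : Fin 3 → ZMod 2) : Submodule ℝ ℍ[ℝ] :=
  Submodule.span ℝ {q | ∃ m : Fin 4, evenDeg m = γ ∧ q = quatBasis m}

lemma evenDeg_zero : evenDeg 0 = 0 := by decide

lemma one_mem_quatComponent : (1 : ℍ[ℝ]) ∈ quatComponent 0 := by
  refine Submodule.subset_span ⟨0, evenDeg_zero, ?_⟩
  ext <;> simp [quatBasis]

lemma quatBasis_mul (m m' : Fin 4) :
    ∃ (c : ℝ) (l : Fin 4), evenDeg l = evenDeg m + evenDeg m' ∧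
      quatBasis m * quatBasis m' = c • quatBasis l := by
  have key : ∀ (c : ℝ) (m m' l : Fin 4),
      (quatBasis m * quatBasis m').re = c * (quatBasis l).re →
      (quatBasis m * quatBasis m').imI = c * (quatBasis l).imI →
      (quatBasis m * quatBasis m').imJ = c * (quatBasis l).imJ →
      (quatBasis m * quatBasis m').imK = c * (quatBasis l).imK →
      quatBasis m * quatBasis m' = c • quatBasis l := fun _ _ _ _ h1 h2 h3 h4 =>
    Quaternion.ext _ _ h1 h2 h3 h4
  have comp : ∀ m, (quatBasis m).re = (![1, 0, 0, 0] : Fin 4 → ℝ) m ∧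
      (quatBasis m).imI = (![0, 1, 0, 0] : Fin 4 → ℝ) m ∧
      (quatBasis m).imJ = (![0, 0, 1, 0] : Fin 4 → ℝ) m ∧
      (quatBasis m).imK = (![0, 0, 0, 1] : Fin 4 → ℝ) m := by
    intro m
    fin_cases m <;> exact ⟨rfl, rfl, rfl, rfl⟩
  let c : Fin 4 → Fin 4 → ℝ := ![![1, 1, 1, 1], ![1, -1, 1, -1], ![1, -1, -1, 1], ![1, 1, -1, -1]]
  let l : Fin 4 → Fin 4 → Fin 4 := ![![0, 1, 2, 3], ![1, 0, 3, 2], ![2, 3, 0, 1], ![3, 2, 1, 0]]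
  refine ⟨c m m', l m m', by revert m m'; decide, key _ _ _ _ ?_ ?_ ?_ ?_⟩ <;>
    simp only [Quaternion.re_mul, Quaternion.imI_mul, Quaternion.imJ_mul, Quaternion.imK_mul,
      (comp _).1, (comp _).2.1, (comp _).2.2.1, (comp _).2.2.2] <;>
    fin_cases m <;> fin_cases m' <;> simp [c, l]

lemma mul_mem_quatComponent {γ δ : Fin 3 → ZMod 2} {p q : ℍ[ℝ]}
    (hp : p ∈ quatComponent γ) (hq : q ∈ quatComponent δ) :
    p * q ∈ quatComponent (γ + δ) := by
  have h : quatComponent γ * quatComponent δ ≤ quatComponent (γ + δ) := by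
    unfold quatComponent
    rw [Submodule.span_mul_span, Submodule.span_le]
    rintro _ ⟨_, ⟨m, rfl, rfl⟩, _, ⟨m', rfl, rfl⟩, rfl⟩
    obtain ⟨c, l, hl, h⟩ := quatBasis_mul m m'
    simp only [h]
    exact Submodule.smul_mem _ _ (Submodule.subset_span ⟨l, hl, rfl⟩)
  exact h (Submodule.mul_mem_mul hp hq)

/-- The degree-`0` component of `ℍ` is `ℝ · 1`; it is identified with `ℝ` below. -/
lemma mem_quatComponent_zero {q : ℍ[ℝ]} : q ∈ quatComponent 0 ↔ ((q.re : ℝ) : ℍ[ℝ]) = q := by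
  constructor
  · intro h
    induction h using Submodule.span_induction with
    | mem x hx =>
      obtain ⟨m, hm, rfl⟩ := hx
      fin_cases m
      · ext <;> simp [quatBasis]
      · exact absurd hm (by decide)
      · exact absurd hm (by decide)
      · exact absurd hm (by decide)
    | zero => simp
    | add x y _ _ hx hy => rw [Quaternion.re_add, Quaternion.coe_add, hx, hy]
    | smul c x _ hx =>
      rw [Quaternion.re_smul, smul_eq_mul, Quaternion.coe_mul, hx, Quaternion.coe_mul_eq_smul]
  · intro h
    have h1 : q = q.re • (1 : ℍ[ℝ]) := by
      rw [← Quaternion.coe_mul_eq_smul, mul_one, h]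
    rw [h1]
    exact Submodule.smul_mem _ _ one_mem_quatComponent

/-- Row and column indices for the rank `r = (r₁, r₂, r₃, r₄)`: a block `k` and a position in it. -/
abbrev Idx (r : Fin 4 → ℕ) : Type := (k : Fin 4) × Fin (r k)

/-- The algebra `M⁰(r; ℍ)` of purely even graded quaternionic matrices of degree `0`:
the entries of the block `X_{ku}` lie in `ℍ^{-γₖ + γᵤ}`. -/
def degZeroMatrix (r : Fin 4 → ℕ) : Subalgebra ℝ (Matrix (Idx r) (Idx r) ℍ[ℝ]) where
  carrier := {X | ∀ a b, X a b ∈ quatComponent (-evenDeg a.1 + evenDeg b.1)}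
  mul_mem' := by
    intro X Y hX hY a b
    rw [Matrix.mul_apply]
    refine Submodule.sum_mem _ fun c _ => ?_
    have h := mul_mem_quatComponent (hX a c) (hY c b)
    have e : -evenDeg a.1 + evenDeg c.1 + (-evenDeg c.1 + evenDeg b.1)
        = -evenDeg a.1 + evenDeg b.1 := by abel
    rwa [e] at h
  add_mem' := by
    intro X Y hX hY a b
    exact Submodule.add_mem _ (hX a b) (hY a b)
  algebraMap_mem' := by
    intro c a b
    rw [Matrix.algebraMap_matrix_apply]
    split_ifs with h
    · subst h
      rw [neg_add_cancel, Algebra.algebraMap_eq_smul_one]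
      exact Submodule.smul_mem _ _ one_mem_quatComponent
    · exact Submodule.zero_mem _

/-- The diagonal block `X_{kk}` of a degree-`0` matrix. Its entries lie in `ℍ⁰ = ℝ · 1`, so that it
is a real matrix. -/
def diagBlock {r : Fin 4 → ℕ} (X : degZeroMatrix r) (k : Fin 4) :
    Matrix (Fin (r k)) (Fin (r k)) ℝ :=
  Matrix.of fun i j => (X.1 ⟨k, i⟩ ⟨k, j⟩).re

/-- No entry is lost in `diagBlock`. -/
lemma coe_diagBlock {r : Fin 4 → ℕ} (X : degZeroMatrix r) (k : Fin 4) (i j : Fin (r k)) :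
    ((diagBlock X k i j : ℝ) : ℍ[ℝ]) = X.1 ⟨k, i⟩ ⟨k, j⟩ := by
  have h := X.2 ⟨k, i⟩ ⟨k, j⟩
  rw [neg_add_cancel] at h
  exact mem_quatComponent_zero.1 h

/-- The diagonal blocks are identity matrices. -/
def HasUnitDiagBlocks {r : Fin 4 → ℕ} (X : degZeroMatrix r) : Prop :=
  ∀ k, diagBlock X k = 1

/-- The defining properties of the graded determinant `Γdet : M⁰(r; ℍ) → ℍ⁰ = ℝ`. -/
structure IsGradedDet (r : Fin 4 → ℕ) (f : degZeroMatrix r → ℝ) : Prop where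
  map_mul : ∀ X Y, f (X * Y) = f X * f Y
  map_blockDiagonal : ∀ X : degZeroMatrix r, (∀ a b, a.1 ≠ b.1 → X.1 a b = 0) →
    f X = ∏ k, (diagBlock X k).det
  map_upperUnitriangular : ∀ X : degZeroMatrix r, HasUnitDiagBlocks X →
    (∀ a b, b.1 < a.1 → X.1 a b = 0) → f X = 1
  map_lowerUnitriangular : ∀ X : degZeroMatrix r, HasUnitDiagBlocks X →
    (∀ a b, a.1 < b.1 → X.1 a b = 0) → f X = 1

/-- The graded determinant: the unique map with the properties `IsGradedDet`. -/
def gradedDet (r : Fin 4 → ℕ) : degZeroMatrix r → ℝ :=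
  Classical.epsilon (IsGradedDet r)

/-- The defining properties of the Dieudonné determinant of square quaternionic matrices, where the
class of `a ∈ ℍˣ` in `ℍˣ / [ℍˣ, ℍˣ] ≅ ℝ_{>0}` is given by the norm `‖a‖`: it is multiplicative,
vanishes on singular matrices, equals `1` on the transvections `1 + c Eᵢⱼ`, `i ≠ j`, and is the
product of the norms of the entries on diagonal matrices. -/
structure IsDieudonneDet {n : Type*} [Fintype n] [DecidableEq n]
    (d : Matrix n n ℍ[ℝ] → ℝ) : Prop where
  map_mul : ∀ X Y, d (X * Y) = d X * d Y
  map_singular : ∀ X, ¬ IsUnit X → d X = 0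
  map_transvection : ∀ (i j : n) (c : ℍ[ℝ]), i ≠ j → d (1 + Matrix.single i j c) = 1
  map_diagonal : ∀ a : n → ℍ[ℝ], d (Matrix.diagonal a) = ∏ i, ‖a i‖

/-- The Dieudonné determinant: the unique map with the properties `IsDieudonneDet`. -/
def dieudonneDet {n : Type*} [Fintype n] [DecidableEq n] : Matrix n n ℍ[ℝ] → ℝ :=
  Classical.epsilon IsDieudonneDet

end GradedQuaternion

end

open scoped Quaternion

/-! Let `Q` be the diagonal matrix carrying the unit basis quaternion of degree `γₖ` throughout
block `k`. Then `A ↦ Q⁻¹ A Q` is an isomorphism from real `N × N` matrices onto `M⁰(r; ℍ)`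
(`realMatrixEquiv`), and it preserves diagonal blocks and zero patterns. Real matrices are products
of diagonal matrices and transvections, and properties 1–3 fix the value on each factor, so the
graded determinant is forced to be `A.det` (`IsGradedDet.map_realMatrixEquiv`). The same
factorization gives `Ddet A = |A.det|`, and `Q` and `Q⁻¹` have Dieudonné determinant 1; hence the
comparison. The Dieudonné determinant exists as the fourth root of the absolute value of the real
determinant of `v ↦ X v`. It is unique by Gaussian elimination over `ℍ`
(`isUnit_transvection_induction`). -/

namespace GradedQuaternion

/-! ### Existence of the Dieudonné determinant -/

section Dieudonne

variable {n : Type*} [Fintype n] [DecidableEq n]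

/-- The `ℝ`-linear endomorphism `v ↦ X v` of `ℍⁿ`. -/
noncomputable def mulVecLinReal (X : Matrix n n ℍ[ℝ]) : (n → ℍ[ℝ]) →ₗ[ℝ] (n → ℍ[ℝ]) where
  toFun v := X.mulVec v
  map_add' := X.mulVec_add
  map_smul' c v := X.mulVec_smul c v

omit [DecidableEq n] in
lemma mulVecLinReal_mul (X Y : Matrix n n ℍ[ℝ]) :
    mulVecLinReal (X * Y) = mulVecLinReal X ∘ₗ mulVecLinReal Y := by
  refine LinearMap.ext fun v => ?_
  exact (Matrix.mulVec_mulVec v X Y).symm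

lemma mulVecLinReal_one : mulVecLinReal (1 : Matrix n n ℍ[ℝ]) = LinearMap.id := by
  refine LinearMap.ext fun v => ?_
  exact Matrix.one_mulVec v

lemma det_mulLeft_quaternion (a : ℍ[ℝ]) :
    LinearMap.det (LinearMap.mulLeft ℝ a) = (‖a‖ * ‖a‖) ^ 2 := by
  rw [← Quaternion.normSq_eq_norm_mul_self, Quaternion.normSq_def']
  refine (LinearMap.det_toMatrix (QuaternionAlgebra.basisOneIJK (-1 : ℝ) 0 (-1))
    (LinearMap.mulLeft ℝ a)).symm.trans ?_
  have h : LinearMap.toMatrix (QuaternionAlgebra.basisOneIJK (-1 : ℝ) 0 (-1))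
      (QuaternionAlgebra.basisOneIJK (-1 : ℝ) 0 (-1)) (LinearMap.mulLeft ℝ a) =
      !![a.re, -a.imI, -a.imJ, -a.imK; a.imI, a.re, -a.imK, a.imJ;
        a.imJ, a.imK, a.re, -a.imI; a.imK, -a.imJ, a.imI, a.re] := by
    ext i j
    -- With explicit basis vectors, the matrix entries become coordinates of products of
    -- quaternions.
    have hb : QuaternionAlgebra.basisOneIJK (-1 : ℝ) 0 (-1) j = quatBasis j := by
      refine (QuaternionAlgebra.basisOneIJK (-1 : ℝ) 0 (-1)).repr.injective ?_
      rw [Module.Basis.repr_self]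
      ext k
      change _ = ![(quatBasis j).re, (quatBasis j).imI, (quatBasis j).imJ, (quatBasis j).imK] k
      fin_cases j <;> fin_cases k <;> simp [quatBasis]
    refine (LinearMap.toMatrix_apply _ _ _ _ _).trans ?_
    rw [hb]
    change ![(a * quatBasis j).re, (a * quatBasis j).imI, (a * quatBasis j).imJ,
      (a * quatBasis j).imK] i = _
    simp only [Quaternion.re_mul, Quaternion.imI_mul, Quaternion.imJ_mul, Quaternion.imK_mul]
    fin_cases i <;> fin_cases j <;> simp [quatBasis]
  rw [h, Matrix.det_succ_row_zero]
  simp [Fin.sum_univ_succ, Matrix.det_fin_three, Fin.succAbove]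
  ring

lemma det_mulVecLinReal_diagonal (a : n → ℍ[ℝ]) :
    LinearMap.det (mulVecLinReal (Matrix.diagonal a)) = (∏ i, (‖a i‖ * ‖a i‖)) ^ 2 := by
  have h : mulVecLinReal (Matrix.diagonal a) =
      LinearMap.pi fun i => (LinearMap.mulLeft ℝ (a i)).comp (LinearMap.proj i) := by
    refine LinearMap.ext fun v => funext fun i => ?_
    exact Matrix.mulVec_diagonal a v i
  rw [h, LinearMap.det_pi, ← Finset.prod_pow]
  exact Finset.prod_congr rfl fun i _ => det_mulLeft_quaternion (a i)

lemma isUnit_of_det_mulVecLinReal_ne_zero {X : Matrix n n ℍ[ℝ]}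
    (h : LinearMap.det (mulVecLinReal X) ≠ 0) : IsUnit X := by
  have hs : Function.Surjective (mulVecLinReal X) :=
    (LinearMap.equivOfDetNeZero (mulVecLinReal X) h).surjective
  choose v hv using fun j : n => hs (Pi.single j 1)
  -- The preimages of the standard basis vectors are the columns of a right inverse, and a one-sided
  -- inverse suffices for square matrices over `ℍ`.
  refine .of_mul_eq_one (Matrix.of fun i j => v j i) ?_
  ext1 i j
  have hij : X.mulVec (v j) i = Pi.single (M := fun _ => ℍ[ℝ]) j 1 i := congrFun (hv j) i
  rw [Matrix.one_apply]
  rw [Pi.single_apply] at hij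
  exact hij

lemma one_add_single_mul_one_add_single_neg {i j : n} (hij : i ≠ j) (c : ℍ[ℝ]) :
    (1 + Matrix.single i j c) * (1 + Matrix.single i j (-c)) = 1 := by
  rw [add_mul, mul_add, mul_add, Matrix.single_mul_single_of_ne _ _ _ _ hij.symm, one_mul, one_mul,
    mul_one, add_zero, add_assoc, ← Matrix.single_add, neg_add_cancel, Matrix.single_zero, add_zero]

/-- A multiplicative real-valued map that does not vanish at the identity is `1` on
transvections. -/
lemma map_one_add_single_eq_one {d : Matrix n n ℍ[ℝ] → ℝ}
    (hmul : ∀ X Y, d (X * Y) = d X * d Y) (h1 : d 1 = 1) {i j : n} (hij : i ≠ j) (c : ℍ[ℝ]) :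
    d (1 + Matrix.single i j c) = 1 := by
  -- Conjugation by `D` doubles `c`, so `D T D⁻¹ = T²`. As `ℝ` is commutative, `d T = (d T)²`, and
  -- `d T ≠ 0` leaves only 1.
  set D : Matrix n n ℍ[ℝ] := Matrix.diagonal (Function.update 1 i 2) with hD
  set E : Matrix n n ℍ[ℝ] := Matrix.diagonal (Function.update 1 i 2⁻¹) with hE
  set T := 1 + Matrix.single i j c with hT
  have hDE : D * E = 1 := by
    rw [hD, hE, Matrix.diagonal_mul_diagonal, ← Matrix.diagonal_one]
    have h2 : (2 : ℍ[ℝ]) ≠ 0 := by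
      have : CharZero ℍ[ℝ] := charZero_of_injective_algebraMap (algebraMap ℝ ℍ[ℝ]).injective
      exact two_ne_zero
    congr 1
    funext k
    by_cases hk : k = i
    · simpa [hk] using mul_inv_cancel₀ h2
    · simp [hk]
  have hTT : D * T = T * T * D := by
    ext1 a b
    have hji : j ≠ i := hij.symm
    have hs : Matrix.single i j c * Matrix.single i j c = 0 := by
      rw [Matrix.single_mul_single_of_ne _ _ _ _ hji]
    have : T * T = 1 + (Matrix.single i j c + Matrix.single i j c) := by
      rw [hT, add_mul, mul_add, mul_add, hs]; simp [add_assoc]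
    rw [this, hD, Matrix.diagonal_mul, Matrix.mul_diagonal, hT]
    by_cases ha : a = i
    · subst ha
      by_cases hb : b = j
      · subst hb
        simp [hij, hji, two_mul]
      · by_cases hba : b = a
        · subst hba
          simp [Ne.symm hb]
        · simp [Ne.symm hb, Ne.symm hba]
    · by_cases hb : b = a
      · subst hb; simp [ha, Ne.symm ha]
      · simp [Ne.symm hb, Ne.symm ha]
  have hd : d D * d E = 1 := by rw [← hmul, hDE, h1]
  have hd0 : d D ≠ 0 := left_ne_zero_of_mul_eq_one hd
  have hTi : T * (1 + Matrix.single i j (-c)) = 1 := one_add_single_mul_one_add_single_neg hij c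
  have ht : d T * d (1 + Matrix.single i j (-c)) = 1 := by rw [← hmul, hTi, h1]
  have ht0 : d T ≠ 0 := left_ne_zero_of_mul_eq_one ht
  have h2 : d D * d T = d T * d T * d D := by rw [← hmul, hTT, hmul, hmul]
  have h3 : d T * d D * d T = d T * d D * 1 := by linear_combination -h2
  exact mul_left_cancel₀ (mul_ne_zero ht0 hd0) h3

lemma exists_isDieudonneDet : ∃ d : Matrix n n ℍ[ℝ] → ℝ, IsDieudonneDet d := by
  -- Left multiplication by `a` has real determinant `‖a‖⁴`, hence the fourth root.
  set d : Matrix n n ℍ[ℝ] → ℝ := fun X => √√|LinearMap.det (mulVecLinReal X)| with hd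
  have hmul : ∀ X Y, d (X * Y) = d X * d Y := fun X Y => by
    simp only [hd]
    rw [mulVecLinReal_mul, LinearMap.det_comp, abs_mul, Real.sqrt_mul (abs_nonneg _),
      Real.sqrt_mul (Real.sqrt_nonneg _)]
  have h1 : d 1 = 1 := by
    simp [hd, mulVecLinReal_one]
  refine ⟨d, hmul, fun X hX => ?_, fun i j c hij => map_one_add_single_eq_one hmul h1 hij c,
    fun a => ?_⟩
  · have h0 : LinearMap.det (mulVecLinReal X) = 0 := by
      by_contra h
      exact hX (isUnit_of_det_mulVecLinReal_ne_zero h)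
    simp [hd, h0]
  · have h0 : 0 ≤ ∏ i, ‖a i‖ := Finset.prod_nonneg fun i _ => norm_nonneg _
    simp only [hd]
    rw [det_mulVecLinReal_diagonal, Finset.prod_mul_distrib, abs_of_nonneg (sq_nonneg _),
      Real.sqrt_sq (mul_nonneg h0 h0), Real.sqrt_mul_self h0]

/-! ### Gaussian elimination over `ℍ` and uniqueness -/

lemma one_add_single_mul_apply (i j : n) (c : ℍ[ℝ]) (M : Matrix n n ℍ[ℝ]) (a b : n) :
    ((1 + Matrix.single i j c) * M) a b = M a b + if a = i then c * M j b else 0 := by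
  rw [add_mul, one_mul, Matrix.add_apply]
  split_ifs with h
  · subst h; rw [Matrix.single_mul_apply_same]
  · rw [Matrix.single_mul_apply_of_ne (h := h)]

lemma isUnit_one_add_single {i j : n} (hij : i ≠ j) (c : ℍ[ℝ]) :
    IsUnit (1 + Matrix.single i j c : Matrix n n ℍ[ℝ]) := by
  exact .of_mul_eq_one _ (one_add_single_mul_one_add_single_neg hij c)

/-- If the columns of an invertible matrix indexed by `s` are diagonal, every other column has a
nonzero entry outside the rows indexed by `s`. -/
lemma exists_ne_zero_of_isUnit {M : Matrix n n ℍ[ℝ]} (hM : IsUnit M) {s : Finset n}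
    (hs : ∀ j ∈ s, ∀ a, a ≠ j → M a j = 0) {t : n} (ht : t ∉ s) :
    ∃ a, a ∉ s ∧ M a t ≠ 0 := by
  by_contra! h
  obtain ⟨⟨M, N, hMN, hNM⟩, rfl⟩ := hM
  simp only at hs h
  have hcol : ∀ j ∈ s, N j j * M j j = 1 := fun j hj => by
    have := congrFun (congrFun hNM j) j
    rwa [Matrix.mul_apply, Finset.sum_eq_single j (fun a _ ha => by rw [hs j hj a ha, mul_zero])
      (by simp), Matrix.one_apply_eq] at this
  -- Row `t` of the inverse vanishes on `s`; if column `t` of `M` vanished off `s`, their product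
  -- could not be 1.
  have hcol0 : ∀ j ∈ s, N t j = 0 := fun j hj => by
    have := congrFun (congrFun hNM t) j
    rw [Matrix.mul_apply, Finset.sum_eq_single j (fun a _ ha => by rw [hs j hj a ha, mul_zero])
      (by simp), Matrix.one_apply_ne (by rintro rfl; exact ht hj)] at this
    exact (mul_eq_zero.1 this).resolve_right (right_ne_zero_of_mul_eq_one (hcol j hj))
  have h1 : (N * M) t t = 0 := by
    rw [Matrix.mul_apply]
    refine Finset.sum_eq_zero fun a _ => ?_
    by_cases ha : a ∈ s
    · rw [hcol0 a ha, zero_mul]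
    · rw [h a ha, mul_zero]
  rw [hNM, Matrix.one_apply_eq] at h1
  exact one_ne_zero h1

/-- Gaussian elimination for invertible quaternionic matrices: a property that is reflected by left
multiplication with transvections and holds for diagonal matrices holds for every invertible
matrix. -/
lemma isUnit_transvection_induction {P : Matrix n n ℍ[ℝ] → Prop}
    (hdiag : ∀ a, P (Matrix.diagonal a))
    (htrans : ∀ (i j : n) (c : ℍ[ℝ]) (M : Matrix n n ℍ[ℝ]), i ≠ j →
      P ((1 + Matrix.single i j c) * M) → P M)
    {M : Matrix n n ℍ[ℝ]} (hM : IsUnit M) : P M := by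
  -- `u` collects the columns not yet made diagonal.
  suffices H : ∀ (u : Finset n) (M : Matrix n n ℍ[ℝ]), IsUnit M →
      (∀ j, j ∉ u → ∀ a, a ≠ j → M a j = 0) → P M from
    H Finset.univ M hM fun j hj => absurd (Finset.mem_univ j) hj
  intro u
  induction u using Finset.induction_on with
  | empty =>
    intro M _ h
    have : M = Matrix.diagonal fun i => M i i := by
      ext1 a j
      rw [Matrix.diagonal_apply]
      split_ifs with haj
      · rw [haj]
      · exact h j (Finset.notMem_empty j) a haj
    rw [this]
    exact hdiag _
  | insert t u ht ih =>
    -- With a nonzero pivot at `t`, `w` bounds the rows of column `t` still to be cleared.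
    have clear : ∀ (w : Finset n) (M : Matrix n n ℍ[ℝ]), IsUnit M →
        (∀ j, j ∉ insert t u → ∀ a, a ≠ j → M a j = 0) → M t t ≠ 0 →
        (∀ a, a ∉ w → a ≠ t → M a t = 0) → P M := by
      intro w
      induction w using Finset.induction_on with
      | empty =>
        intro M hM h _ hw
        refine ih M hM fun j hj a ha => ?_
        by_cases hjt : j = t
        · subst hjt; exact hw a (Finset.notMem_empty a) ha
        · exact h j (by simp [hjt, hj]) a ha
      | insert b w hb ihw =>
        intro M hM h htt hw
        by_cases hbt : b = t
        · subst hbt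
          exact ihw M hM h htt fun a ha hab => hw a (by simp [ha, hab]) hab
        · refine htrans b t (-(M b t * (M t t)⁻¹)) M hbt
            (ihw _ ((isUnit_one_add_single hbt _).mul hM) ?_ ?_ ?_)
          · intro j hj a ha
            have htj : t ≠ j := by rintro rfl; exact hj (Finset.mem_insert_self _ _)
            rw [one_add_single_mul_apply, h j hj a ha, h j hj t htj]
            simp
          · rw [one_add_single_mul_apply, if_neg (Ne.symm hbt), add_zero]
            exact htt
          · intro a ha hat
            rw [one_add_single_mul_apply]
            split_ifs with hab
            · subst hab
              rw [neg_mul, mul_assoc, inv_mul_cancel₀ htt, mul_one, add_neg_cancel]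
            · rw [add_zero]
              exact hw a (by simp [ha, hab]) hat
    intro M hM h
    by_cases htt : M t t = 0
    -- A zero pivot is repaired by adding a row `a` to row `t`, without a swap. Choosing `a` among
    -- the unfinished indices keeps the finished columns diagonal.
    · obtain ⟨a, ha, hat⟩ := exists_ne_zero_of_isUnit hM (s := (insert t u)ᶜ)
        (fun j hj => h j (by simpa using hj)) (t := t) (by simp)
      have hta : t ≠ a := by rintro rfl; exact hat htt
      have ha' : a ∈ insert t u := by
        rwa [Finset.mem_compl, not_not] at ha
      refine htrans t a 1 M hta
        (clear Finset.univ _ ((isUnit_one_add_single hta _).mul hM) ?_ ?_ (by simp))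
      · intro j hj b hb
        have haj : a ≠ j := by rintro rfl; exact hj ha'
        rw [one_add_single_mul_apply, h j hj b hb, h j hj a haj]
        simp
      · rw [one_add_single_mul_apply, htt]
        simpa using hat
    · exact clear Finset.univ M hM h htt (by simp)

lemma IsDieudonneDet.unique {d d' : Matrix n n ℍ[ℝ] → ℝ} (h : IsDieudonneDet d)
    (h' : IsDieudonneDet d') : d = d' := by
  funext M
  by_cases hM : IsUnit M
  · refine isUnit_transvection_induction (P := fun M => d M = d' M) ?_ ?_ hM
    · intro a
      rw [h.map_diagonal, h'.map_diagonal]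
    · intro i j c M hij hP
      rwa [h.map_mul, h'.map_mul, h.map_transvection i j c hij, h'.map_transvection i j c hij,
        one_mul, one_mul] at hP
  · rw [h.map_singular M hM, h'.map_singular M hM]

lemma isDieudonneDet_dieudonneDet : IsDieudonneDet (dieudonneDet (n := n)) :=
  Classical.epsilon_spec exists_isDieudonneDet

/-- Both sides are multiplicative and agree on real transvections and diagonal matrices; zero
diagonal entries take care of singular `A`. -/
lemma IsDieudonneDet.map_ofReal {d : Matrix n n ℍ[ℝ] → ℝ} (h : IsDieudonneDet d)
    (A : Matrix n n ℝ) : d (A.map (algebraMap ℝ ℍ[ℝ])) = |A.det| := by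
  induction A using Matrix.diagonal_transvection_induction with
  | hdiag D _ =>
    rw [Matrix.diagonal_map (map_zero _), h.map_diagonal, Matrix.det_diagonal, Finset.abs_prod]
    refine Finset.prod_congr rfl fun i _ => ?_
    simp
  | htransvec t =>
    have : t.toMatrix.map (algebraMap ℝ ℍ[ℝ]) =
        1 + Matrix.single t.i t.j (algebraMap ℝ ℍ[ℝ] t.c) := by
      rw [Matrix.TransvectionStruct.toMatrix, Matrix.transvection, Matrix.map_add _ (map_add _),
        Matrix.map_one _ (map_zero _) (map_one _), Matrix.map_single]
    rw [this, h.map_transvection _ _ _ t.hij, Matrix.TransvectionStruct.det, abs_one]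
  | hmul A B hA hB =>
    rw [Matrix.map_mul, h.map_mul, hA, hB, Matrix.det_mul, abs_mul]

end Dieudonne

end GradedQuaternion

namespace GradedQuaternion

/-! ### Degree-0 matrices as conjugates of real matrices -/

section GradedDet

lemma star_mul_quatBasis (m : Fin 4) : star (quatBasis m) * quatBasis m = 1 := by
  rw [Quaternion.star_mul_self, Quaternion.normSq_def']
  fin_cases m <;> simp [quatBasis]

lemma quatBasis_mul_star (m : Fin 4) : quatBasis m * star (quatBasis m) = 1 := by
  rw [Quaternion.self_mul_star, Quaternion.normSq_def']
  fin_cases m <;> simp [quatBasis]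

lemma norm_quatBasis (m : Fin 4) : ‖quatBasis m‖ = 1 := by
  have h : ‖quatBasis m‖ * ‖quatBasis m‖ = 1 := by
    rw [← Quaternion.normSq_eq_norm_mul_self, Quaternion.normSq_def']
    fin_cases m <;> simp [quatBasis]
  exact (mul_self_eq_one_iff.1 h).resolve_right fun h' => by linarith [norm_nonneg (quatBasis m)]

lemma neg_evenDeg (m : Fin 4) : -evenDeg m = evenDeg m := by
  revert m; decide

lemma quatBasis_mem (m : Fin 4) : quatBasis m ∈ quatComponent (evenDeg m) :=
  Submodule.subset_span ⟨m, rfl, rfl⟩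

lemma star_quatBasis_mem (m : Fin 4) : star (quatBasis m) ∈ quatComponent (evenDeg m) := by
  have h : star (quatBasis m) = quatBasis m ∨ star (quatBasis m) = -quatBasis m := by
    fin_cases m
    · left
      ext <;> simp only [Quaternion.re_star, Quaternion.imI_star, Quaternion.imJ_star,
        Quaternion.imK_star]
      all_goals simp [quatBasis]
    all_goals
      right
      ext <;> simp only [Quaternion.re_star, Quaternion.imI_star, Quaternion.imJ_star,
        Quaternion.imK_star, Quaternion.re_neg, Quaternion.imI_neg, Quaternion.imJ_neg,
        Quaternion.imK_neg]
      all_goals simp [quatBasis]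
  rcases h with h | h <;> rw [h]
  · exact quatBasis_mem m
  · exact neg_mem (quatBasis_mem m)

lemma coe_mem_quatComponent_zero (c : ℝ) : (c : ℍ[ℝ]) ∈ quatComponent 0 :=
  mem_quatComponent_zero.2 (by rw [Quaternion.re_coe])

variable {r : Fin 4 → ℕ}

/-- The degrees add up to `γₐ - γₐ + γ_b + γ_b`, which is zero mod 2. -/
lemma conj_mem_quatComponent_zero (X : degZeroMatrix r) (a b : Idx r) :
    quatBasis a.1 * X.1 a b * star (quatBasis b.1) ∈ quatComponent 0 := by
  have h := mul_mem_quatComponent (mul_mem_quatComponent (quatBasis_mem a.1) (X.2 a b))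
    (star_quatBasis_mem b.1)
  rwa [← add_assoc, add_neg_cancel, zero_add,
    eq_neg_iff_add_eq_zero.1 (neg_evenDeg b.1).symm] at h

lemma coe_re_conj (X : degZeroMatrix r) (a b : Idx r) :
    (((quatBasis a.1 * X.1 a b * star (quatBasis b.1)).re : ℝ) : ℍ[ℝ]) =
      quatBasis a.1 * X.1 a b * star (quatBasis b.1) :=
  mem_quatComponent_zero.1 (conj_mem_quatComponent_zero X a b)

/-- Conjugation with the diagonal matrix that carries the basis quaternion of degree `γₖ` in the
block `k` identifies real matrices with graded quaternionic matrices of degree `0`. -/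
noncomputable def realMatrixEquiv (r : Fin 4 → ℕ) :
    Matrix (Idx r) (Idx r) ℝ ≃* degZeroMatrix r where
  toFun A := ⟨Matrix.of fun a b => star (quatBasis a.1) * (A a b : ℍ[ℝ]) * quatBasis b.1, by
    intro a b
    have h := mul_mem_quatComponent (mul_mem_quatComponent (star_quatBasis_mem a.1)
      (coe_mem_quatComponent_zero (A a b))) (quatBasis_mem b.1)
    rwa [add_zero, ← neg_evenDeg a.1] at h⟩
  invFun X := Matrix.of fun a b => (quatBasis a.1 * X.1 a b * star (quatBasis b.1)).re
  left_inv A := by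
    ext a b
    simp only [Matrix.of_apply]
    rw [← mul_assoc, ← mul_assoc, quatBasis_mul_star, one_mul, mul_assoc, quatBasis_mul_star,
      mul_one, Quaternion.re_coe]
  right_inv X := by
    refine Subtype.ext (Matrix.ext fun a b => ?_)
    simp only [Matrix.of_apply]
    rw [coe_re_conj, ← mul_assoc, ← mul_assoc, star_mul_quatBasis, one_mul, mul_assoc,
      star_mul_quatBasis, mul_one]
  map_mul' A B := by
    refine Subtype.ext (Matrix.ext fun a b => ?_)
    change star (quatBasis a.1) * (((A * B) a b : ℝ) : ℍ[ℝ]) * quatBasis b.1 =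
      ∑ c, star (quatBasis a.1) * (A a c : ℍ[ℝ]) * quatBasis c.1 *
        (star (quatBasis c.1) * (B c b : ℍ[ℝ]) * quatBasis b.1)
    have h : (((A * B) a b : ℝ) : ℍ[ℝ]) = ∑ c, (A a c : ℍ[ℝ]) * (B c b : ℍ[ℝ]) := by
      rw [Matrix.mul_apply, ← Quaternion.algebraMap_def, map_sum]
      simp only [map_mul, Quaternion.algebraMap_def]
    rw [h, Finset.mul_sum, Finset.sum_mul]
    refine Finset.sum_congr rfl fun c _ => ?_
    have hc : ∀ p q s t : ℍ[ℝ], p * q * quatBasis c.1 * (star (quatBasis c.1) * s * t) =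
        p * q * (quatBasis c.1 * star (quatBasis c.1)) * s * t := fun p q s t => by
      simp only [mul_assoc]
    rw [hc, quatBasis_mul_star, mul_one]
    simp only [mul_assoc]

lemma realMatrixEquiv_apply (A : Matrix (Idx r) (Idx r) ℝ) (a b : Idx r) :
    (realMatrixEquiv r A).1 a b = star (quatBasis a.1) * (A a b : ℍ[ℝ]) * quatBasis b.1 :=
  rfl

lemma realMatrixEquiv_apply_eq_zero_iff (A : Matrix (Idx r) (Idx r) ℝ) (a b : Idx r) :
    (realMatrixEquiv r A).1 a b = 0 ↔ A a b = 0 := by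
  have h1 := right_ne_zero_of_mul_eq_one (quatBasis_mul_star a.1)
  have h2 := left_ne_zero_of_mul_eq_one (quatBasis_mul_star b.1)
  rw [realMatrixEquiv_apply, mul_eq_zero, mul_eq_zero, or_iff_left h2, or_iff_right h1]
  exact (map_eq_zero (algebraMap ℝ ℍ[ℝ]))

/-- Inside a block both conjugating factors come from the same unit quaternion, and real entries are
central, so they cancel. -/
lemma diagBlock_realMatrixEquiv (A : Matrix (Idx r) (Idx r) ℝ) (k : Fin 4) :
    diagBlock (realMatrixEquiv r A) k = Matrix.of fun i j => A ⟨k, i⟩ ⟨k, j⟩ := by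
  ext i j
  rw [diagBlock, Matrix.of_apply, Matrix.of_apply, realMatrixEquiv_apply,
    ← Quaternion.coe_commutes, mul_assoc, star_mul_quatBasis, mul_one, Quaternion.re_coe]

/-! ### Existence and uniqueness of the graded determinant -/

lemma det_eq_prod_diagBlock {A : Matrix (Idx r) (Idx r) ℝ} (h : A.BlockTriangular Sigma.fst) :
    A.det = ∏ k, (diagBlock (realMatrixEquiv r A) k).det := by
  rw [h.det_fintype]
  refine Finset.prod_congr rfl fun k _ => ?_
  rw [diagBlock_realMatrixEquiv, ← Matrix.det_submatrix_equiv_self (Equiv.sigmaSubtype k).symm]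
  rfl

lemma diagBlock_realMatrixEquiv_transpose (A : Matrix (Idx r) (Idx r) ℝ) (k : Fin 4) :
    diagBlock (realMatrixEquiv r A.transpose) k = (diagBlock (realMatrixEquiv r A) k).transpose := by
  rw [diagBlock_realMatrixEquiv, diagBlock_realMatrixEquiv]
  rfl

lemma isGradedDet_det : IsGradedDet r fun X => ((realMatrixEquiv r).symm X).det where
  map_mul X Y := by rw [map_mul, Matrix.det_mul]
  map_blockDiagonal X h := by
    obtain ⟨A, rfl⟩ := (realMatrixEquiv r).surjective X
    rw [MulEquiv.symm_apply_apply]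
    exact det_eq_prod_diagBlock fun a b hab =>
      (realMatrixEquiv_apply_eq_zero_iff A a b).1 (h a b hab.ne')
  map_upperUnitriangular X h1 h := by
    obtain ⟨A, rfl⟩ := (realMatrixEquiv r).surjective X
    rw [MulEquiv.symm_apply_apply, det_eq_prod_diagBlock fun a b hab =>
      (realMatrixEquiv_apply_eq_zero_iff A a b).1 (h a b hab)]
    exact Finset.prod_eq_one fun k _ => by rw [h1 k, Matrix.det_one]
  map_lowerUnitriangular X h1 h := by
    obtain ⟨A, rfl⟩ := (realMatrixEquiv r).surjective X
    have hA : A.transpose.BlockTriangular Sigma.fst := fun a b hab =>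
      (realMatrixEquiv_apply_eq_zero_iff A b a).1 (h b a hab)
    -- Transposition is applied on the real side, where it preserves the determinant.
    rw [MulEquiv.symm_apply_apply, ← Matrix.det_transpose, det_eq_prod_diagBlock hA]
    refine Finset.prod_eq_one fun k _ => ?_
    rw [diagBlock_realMatrixEquiv_transpose, h1 k, Matrix.transpose_one, Matrix.det_one]

lemma IsGradedDet.map_realMatrixEquiv_of_blockDiagonal {f : degZeroMatrix r → ℝ}
    (hf : IsGradedDet r f) {A : Matrix (Idx r) (Idx r) ℝ} (h : ∀ a b, a.1 ≠ b.1 → A a b = 0) :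
    f (realMatrixEquiv r A) = A.det := by
  rw [hf.map_blockDiagonal _ fun a b hab =>
    (realMatrixEquiv_apply_eq_zero_iff A a b).2 (h a b hab)]
  exact (det_eq_prod_diagBlock fun a b hab => h a b hab.ne').symm

lemma hasUnitDiagBlocks_transvection {i j : Idx r} (hij : i.1 ≠ j.1) (c : ℝ) :
    HasUnitDiagBlocks (realMatrixEquiv r (Matrix.transvection i j c)) := by
  intro k
  rw [diagBlock_realMatrixEquiv]
  ext a b
  have h : ¬(i = ⟨k, a⟩ ∧ j = ⟨k, b⟩) := by
    rintro ⟨rfl, rfl⟩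
    exact hij rfl
  rw [Matrix.of_apply, Matrix.transvection, Matrix.add_apply, Matrix.single_apply, if_neg h,
    add_zero, Matrix.one_apply, Matrix.one_apply]
  simp

lemma transvection_apply_eq_zero {i j a b : Idx r} (c : ℝ) (hab : a.1 ≠ b.1)
    (h : ¬(i = a ∧ j = b)) : Matrix.transvection i j c a b = 0 := by
  have : a ≠ b := fun h => hab (congrArg Sigma.fst h)
  rw [Matrix.transvection, Matrix.add_apply, Matrix.single_apply, if_neg h, Matrix.one_apply_ne this,
    add_zero]

/-- A transvection within one block is block-diagonal, and one between different blocks is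
block-unitriangular, so the axioms evaluate `f` on every generator. -/
lemma IsGradedDet.map_realMatrixEquiv {f : degZeroMatrix r → ℝ} (hf : IsGradedDet r f)
    (A : Matrix (Idx r) (Idx r) ℝ) : f (realMatrixEquiv r A) = A.det := by
  induction A using Matrix.diagonal_transvection_induction with
  | hdiag D _ =>
    exact hf.map_realMatrixEquiv_of_blockDiagonal fun a b hab =>
      Matrix.diagonal_apply_ne _ fun h => hab (congrArg Sigma.fst h)
  | htransvec t =>
    obtain ⟨i, j, hij, c⟩ := t
    rw [Matrix.TransvectionStruct.toMatrix_mk, Matrix.det_transvection_of_ne i j hij]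
    rcases lt_trichotomy i.1 j.1 with h | h | h
    · refine hf.map_upperUnitriangular _ (hasUnitDiagBlocks_transvection h.ne c) fun a b hab =>
        (realMatrixEquiv_apply_eq_zero_iff _ a b).2 (transvection_apply_eq_zero c hab.ne' ?_)
      rintro ⟨rfl, rfl⟩
      exact lt_asymm h hab
    · rw [hf.map_realMatrixEquiv_of_blockDiagonal, Matrix.det_transvection_of_ne i j hij]
      intro a b hab
      refine transvection_apply_eq_zero c hab ?_
      rintro ⟨rfl, rfl⟩
      exact hab h
    · refine hf.map_lowerUnitriangular _ (hasUnitDiagBlocks_transvection h.ne' c) fun a b hab =>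
        (realMatrixEquiv_apply_eq_zero_iff _ a b).2 (transvection_apply_eq_zero c hab.ne ?_)
      rintro ⟨rfl, rfl⟩
      exact lt_asymm h hab
  | hmul A B hA hB =>
    rw [_root_.map_mul, hf.map_mul, hA, hB, Matrix.det_mul]

/-! ### Comparison of the two determinants -/

lemma IsDieudonneDet.map_realMatrixEquiv {d : Matrix (Idx r) (Idx r) ℍ[ℝ] → ℝ}
    (hd : IsDieudonneDet d) (A : Matrix (Idx r) (Idx r) ℝ) :
    d (realMatrixEquiv r A).1 = |A.det| := by
  have h : (realMatrixEquiv r A).1 = Matrix.diagonal (fun a => star (quatBasis a.1)) *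
      A.map (algebraMap ℝ ℍ[ℝ]) * Matrix.diagonal fun a => quatBasis a.1 := by
    ext1 a b
    rw [Matrix.mul_diagonal, Matrix.diagonal_mul]
    rfl
  rw [h, hd.map_mul, hd.map_mul, hd.map_ofReal, hd.map_diagonal, hd.map_diagonal]
  simp [norm_star, norm_quatBasis]

end GradedDet

end GradedQuaternion

theorem proposition7p1 (r : Fin 4 → ℕ) :
    (∃! f : GradedQuaternion.degZeroMatrix r → ℝ, GradedQuaternion.IsGradedDet r f) ∧
    (∃! d : Matrix (GradedQuaternion.Idx r) (GradedQuaternion.Idx r) (Quaternion ℝ) → ℝ,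
      GradedQuaternion.IsDieudonneDet d) ∧
    ∀ X : GradedQuaternion.degZeroMatrix r,
      |GradedQuaternion.gradedDet r X| = GradedQuaternion.dieudonneDet X.1 := by
  refine ⟨⟨_, GradedQuaternion.isGradedDet_det, fun f hf => funext fun X => ?_⟩,
    ⟨_, GradedQuaternion.isDieudonneDet_dieudonneDet,
      fun d hd => hd.unique GradedQuaternion.isDieudonneDet_dieudonneDet⟩, fun X => ?_⟩
  · obtain ⟨A, rfl⟩ := (GradedQuaternion.realMatrixEquiv r).surjective X
    rw [hf.map_realMatrixEquiv, MulEquiv.symm_apply_apply]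
  · have hf : GradedQuaternion.IsGradedDet r (GradedQuaternion.gradedDet r) :=
      Classical.epsilon_spec ⟨_, GradedQuaternion.isGradedDet_det⟩
    obtain ⟨A, rfl⟩ := (GradedQuaternion.realMatrixEquiv r).surjective X
    rw [hf.map_realMatrixEquiv,
      GradedQuaternion.isDieudonneDet_dieudonneDet.map_realMatrixEquiv]
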